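/- Let $F_n$ be the free group with basis $x_1,\dots,x_n$. For a group $G$ and $x\in G$ let $\mathrm{tr}\,x$ be the function $\rho\mapsto \mathrm{tr}\,\rho(x)$ on $\mathrm{Hom}(G,\mathrm{SL}(2,\mathbb C))$, and let $\mathfrak X_{\mathbb Q}(G)$ be the $\mathbb Q$-span of all $\mathrm{tr}\,x$ ($x\in G$) in the algebra of complex-valued functions on $\mathrm{Hom}(G,\mathrm{SL}(2,\mathbb C))$; it is a $\mathbb Q$-algebra under pointwise operations, on which $\mathrm{Aut}\,G$ acts by $\sigma\cdot\mathrm{tr}\,x=\mathrm{tr}\,\sigma(x)$. Let $J_{F_n}$ be the ideal of $\mathfrak X_{\mathbb Q}(F_n)$ generated by all $\mathrm{tr}(x_{i_1}\cdots x_{i_l})-2$ with $1\le l\le 3$ and $1\le i_1<\cdots<i_l\le n$; it is $\mathrm{Aut}\,F_n$-invariant. For $k\ge 1$ put $\mathrm{gr}^k(J_{F_n})=J_{F_n}^k/J_{F_n}^{k+1}$, a $\mathbb Q$-vector space, let $\mathcal E_{F_n}(k)$ be the subgroup of all automorphisms of $F_n$ acting trivially on $J_{F_n}/J_{F_n}^{k+1}$,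 and put $\mathrm{gr}^k(\mathcal E_{F_n})=\mathcal E_{F_n}(k)/\mathcal E_{F_n}(k+1)$. Let $$\eta_k:\mathrm{gr}^k(\mathcal E_{F_n})\to \mathrm{Hom}_{\mathbb Q}\big(\mathrm{gr}^1(J_{F_n}),\mathrm{gr}^{k+1}(J_{F_n})\big),\qquad [\sigma]\mapsto\big([f]\mapsto[\sigma\cdot f-f]\big),$$ which is a well-defined group homomorphism, and let $\mathrm{Coker}(\eta_k)$ be the quotient of the target by the $\mathbb Q$-span of the image of $\eta_k$ (that is, the cokernel of the $\mathbb Q$-linear extension of $\eta_k$ to $\mathrm{gr}^k(\mathcal E_{F_n})\otimes_{\mathbb Z}\mathbb Q$). Then for all integers $n\ge 3$ and $k\ge 2$, $$\dim_{\mathbb Q}\mathrm{Coker}(\eta_k)\ \ge\ \Big(n+\binom n2+\binom n3\Big)\sum_{l=0}^{k+1}\binom{n}{2l}\binom{n+k-l}{k+1-l}.$$ -/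

import Mathlib

open scoped MatrixGroups

noncomputable section

namespace Fricke

/-! ### The ring of Fricke characters of a group -/

section Ring

variable (G : Type*) [Group G]

/-- The Fricke character of `x`: the function `ρ ↦ tr ρ(x)` on `Hom(G, SL(2, ℂ))`. -/
def charFun {G : Type*} [Group G] (x : G) : (G →* SL(2, ℂ)) → ℂ :=
  fun ρ => Matrix.trace (ρ x : Matrix (Fin 2) (Fin 2) ℂ)

theorem charFun_mul_charFun {G : Type*} [Group G] (x y : G) :
    charFun x * charFun y = charFun (x * y) + charFun (x * y⁻¹) := by
  funext ρ
  simp only [charFun, Pi.mul_apply, Pi.add_apply, map_mul, map_inv,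
    Matrix.SpecialLinearGroup.coe_mul, Matrix.SpecialLinearGroup.coe_inv,
    Matrix.adjugate_fin_two, Matrix.trace_fin_two, Matrix.mul_apply, Fin.sum_univ_two]
  simp
  ring

theorem charFun_one {G : Type*} [Group G] : charFun (1 : G) = 2 := by
  funext ρ
  simp [charFun]

/-- The underlying `ℚ`-subalgebra of `𝔛_ℚ(G)`: the `ℚ`-linear span of the Fricke
characters `tr x`, `x ∈ G`, inside the algebra of all functions `Hom(G, SL(2, ℂ)) → ℂ`
(with pointwise operations). -/
def subalgebra : Subalgebra ℚ ((G →* SL(2, ℂ)) → ℂ) :=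
  (Submodule.span ℚ (Set.range (charFun (G := G)))).toSubalgebra
    (by
      have h : (1 : (G →* SL(2, ℂ)) → ℂ) = (1 / 2 : ℚ) • charFun (1 : G) := by
        funext ρ
        simp [charFun_one, Algebra.smul_def]
      rw [h]
      exact Submodule.smul_mem _ _ (Submodule.subset_span ⟨1, rfl⟩))
    (by
      intro a b ha hb
      have h := Submodule.mul_mem_mul ha hb
      rw [Submodule.span_mul_span] at h
      refine (Submodule.span_le.2 ?_) h
      rintro _ ⟨_, ⟨x, rfl⟩, _, ⟨y, rfl⟩, rfl⟩
      simp only [charFun_mul_charFun]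
      exact Submodule.add_mem _ (Submodule.subset_span ⟨_, rfl⟩)
        (Submodule.subset_span ⟨_, rfl⟩))

/-- The ring `𝔛_ℚ(G)` of Fricke characters of `G` over `ℚ`. -/
def CharRing : Type _ := ↥(subalgebra G)

instance : CommRing (CharRing G) := inferInstanceAs (CommRing ↥(subalgebra G))

instance : Algebra ℚ (CharRing G) := inferInstanceAs (Algebra ℚ ↥(subalgebra G))

variable {G}

/-- The Fricke character `tr x` as an element of `𝔛_ℚ(G)`. -/
def tr (x : G) : CharRing G := ⟨charFun x, Submodule.subset_span ⟨x, rfl⟩⟩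

/-- `tr' x = tr x - 2`. -/
def tr' (x : G) : CharRing G := tr x - 2

/-- The action of `Aut G` on `𝔛_ℚ(G)`, by `(σ χ)(ρ) = χ(ρ ∘ σ)`; thus `σ (tr x) = tr (σ x)`. -/
def action : MulAut G →* (CharRing G →ₐ[ℚ] CharRing G) where
  toFun σ :=
    { toFun := fun χ => ⟨fun ρ => χ.1 (ρ.comp σ.toMonoidHom), by
        obtain ⟨χ, hχ⟩ := χ
        change χ ∈ Submodule.span ℚ (Set.range (charFun (G := G))) at hχ
        change (fun ρ : G →* SL(2, ℂ) => χ (ρ.comp σ.toMonoidHom)) ∈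
          Submodule.span ℚ (Set.range (charFun (G := G)))
        induction hχ using Submodule.span_induction with
        | mem f hf =>
          obtain ⟨x, rfl⟩ := hf
          exact Submodule.subset_span ⟨σ x, rfl⟩
        | zero => exact Submodule.zero_mem _
        | add f g _ _ hf hg => exact Submodule.add_mem _ hf hg
        | smul c f _ hf => exact Submodule.smul_mem _ c hf⟩
      map_one' := rfl
      map_mul' := fun _ _ => rfl
      map_zero' := rfl
      map_add' := fun _ _ => rfl
      commutes' := fun _ => rfl }
  map_one' := rfl
  map_mul' _ _ := rfl

theorem action_tr (σ : MulAut G) (x : G) : action σ (tr x) = tr (σ x) := rfl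

theorem action_tr' (σ : MulAut G) (x : G) : action σ (tr' x) = tr' (σ x) := by
  rw [tr', map_sub, action_tr, map_ofNat, tr']

theorem tr_one : tr (1 : G) = 2 := Subtype.ext charFun_one

theorem tr_mul_comm (x y : G) : tr (x * y) = tr (y * x) := by
  apply Subtype.ext
  funext ρ
  simp only [tr, charFun, map_mul, Matrix.SpecialLinearGroup.coe_mul]
  exact Matrix.trace_mul_comm _ _

theorem tr_mul_inv (x y : G) : tr (x * y⁻¹) = tr x * tr y - tr (x * y) := by
  apply Subtype.ext
  change charFun (x * y⁻¹) = charFun x * charFun y - charFun (x * y)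
  rw [charFun_mul_charFun]
  ring

theorem tr_swap (x y z : G) : tr (x * y * z) + tr (y * x * z) =
    tr x * tr (y * z) + tr y * tr (x * z) + tr z * tr (x * y) - tr x * tr y * tr z := by
  apply Subtype.ext
  change charFun (x * y * z) + charFun (y * x * z) =
    charFun x * charFun (y * z) + charFun y * charFun (x * z) + charFun z * charFun (x * y)
      - charFun x * charFun y * charFun z
  funext ρ
  simp only [charFun, Pi.mul_apply, Pi.add_apply, Pi.sub_apply, map_mul,
    Matrix.SpecialLinearGroup.coe_mul, Matrix.trace_fin_two, Matrix.mul_apply,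
    Fin.sum_univ_two]
  ring

theorem two_mul_tr (x y z w : G) : 2 * tr (x * y * z * w) =
    tr x * tr (y * z * w) + tr y * tr (z * w * x) + tr z * tr (w * x * y) + tr w * tr (x * y * z)
    + tr (x * y) * tr (z * w) - tr (x * z) * tr (y * w) + tr (x * w) * tr (y * z)
    - tr x * tr y * tr (z * w) - tr y * tr z * tr (x * w) - tr x * tr w * tr (y * z)
    - tr z * tr w * tr (x * y) + tr x * tr y * tr z * tr w := by
  apply Subtype.ext
  change 2 * charFun (x * y * z * w) =
    charFun x * charFun (y * z * w) + charFun y * charFun (z * w * x)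
    + charFun z * charFun (w * x * y) + charFun w * charFun (x * y * z)
    + charFun (x * y) * charFun (z * w) - charFun (x * z) * charFun (y * w)
    + charFun (x * w) * charFun (y * z)
    - charFun x * charFun y * charFun (z * w) - charFun y * charFun z * charFun (x * w)
    - charFun x * charFun w * charFun (y * z)
    - charFun z * charFun w * charFun (x * y) + charFun x * charFun y * charFun z * charFun w
  funext ρ
  simp only [charFun, Pi.mul_apply, Pi.add_apply, Pi.sub_apply, Pi.ofNat_apply, map_mul,
    Matrix.SpecialLinearGroup.coe_mul, Matrix.trace_fin_two, Matrix.mul_apply,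
    Fin.sum_univ_two]
  ring

end Ring

/-! ### The filtration of the ring of Fricke characters of a free group -/

/-- The ideal `J` of `𝔛_ℚ(F_n)` generated by all `tr' (x_{i_1} ⋯ x_{i_l})` with `1 ≤ l ≤ 3` and
`i_1 < ⋯ < i_l`, where `x_i = FreeGroup.of i` is the standard basis of `F_n`. -/
def J (n : ℕ) : Ideal (CharRing (FreeGroup (Fin n))) :=
  Ideal.span
    ({f | ∃ i : Fin n, f = tr' (FreeGroup.of i)} ∪
     {f | ∃ i j : Fin n, i < j ∧ f = tr' (FreeGroup.of i * FreeGroup.of j)} ∪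
     {f | ∃ i j l : Fin n, i < j ∧ j < l ∧
        f = tr' (FreeGroup.of i * FreeGroup.of j * FreeGroup.of l)})

section Invariance

variable {n : ℕ} {A : Type} [CommRing A] (φ : CharRing (FreeGroup (Fin n)) →+* A)

/-- The image of `tr x` in a quotient; auxiliary, for the proof that `J` is invariant. -/
def trMod (x : FreeGroup (Fin n)) : A := φ (tr x)

theorem trMod_mul_comm (x y : FreeGroup (Fin n)) : trMod φ (x * y) = trMod φ (y * x) := by
  rw [trMod, tr_mul_comm, trMod]

theorem trMod_mul_inv (x y : FreeGroup (Fin n)) :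
    trMod φ (x * y⁻¹) = trMod φ x * trMod φ y - trMod φ (x * y) := by
  simp only [trMod, tr_mul_inv, map_sub, map_mul]

theorem trMod_one : trMod φ (1 : FreeGroup (Fin n)) = 2 := by
  rw [trMod, tr_one, map_ofNat]

variable {φ}

theorem trMod_eq_two (hφ : ∀ f ∈ J n, φ f = 0)
    {x : FreeGroup (Fin n)} (h : tr' x ∈ J n) : trMod φ x = 2 := by
  have h' := hφ _ h
  rw [tr', map_sub, map_ofNat, sub_eq_zero] at h'
  exact h'

theorem trMod_of (hφ : ∀ f ∈ J n, φ f = 0)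
    (i : Fin n) : trMod φ (FreeGroup.of i) = 2 :=
  trMod_eq_two hφ (Ideal.subset_span (Or.inl (Or.inl ⟨i, rfl⟩)))

theorem trMod_of_mul_of (hφ : ∀ f ∈ J n, φ f = 0)
    (i j : Fin n) : trMod φ (FreeGroup.of i * FreeGroup.of j) = 2 := by
  rcases lt_trichotomy i j with h | rfl | h
  · exact trMod_eq_two hφ (Ideal.subset_span (Or.inl (Or.inr ⟨i, j, h, rfl⟩)))
  · have h := trMod_mul_inv φ (FreeGroup.of i) (FreeGroup.of i)
    rw [mul_inv_cancel, trMod_one φ, trMod_of hφ] at h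
    linear_combination h
  · rw [trMod_mul_comm]
    exact trMod_eq_two hφ (Ideal.subset_span (Or.inl (Or.inr ⟨j, i, h, rfl⟩)))

theorem trMod_swap (hφ : ∀ f ∈ J n, φ f = 0)
    (i j l : Fin n) :
    trMod φ (FreeGroup.of i * FreeGroup.of j * FreeGroup.of l) +
      trMod φ (FreeGroup.of j * FreeGroup.of i * FreeGroup.of l) = 4 := by
  have h := congrArg φ
    (tr_swap (FreeGroup.of i) (FreeGroup.of j) (FreeGroup.of l))
  simp only [map_sub, map_add, map_mul] at h
  change trMod φ _ + trMod φ _ =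
    trMod φ _ * trMod φ _ + trMod φ _ * trMod φ _ + trMod φ _ * trMod φ _
    - trMod φ _ * trMod φ _ * trMod φ _ at h
  simp only [trMod_of hφ, trMod_of_mul_of hφ] at h
  linear_combination h

theorem trMod_of_mul_of_mul_of (hφ : ∀ f ∈ J n, φ f = 0)
    (i j l : Fin n) :
    trMod φ (FreeGroup.of i * FreeGroup.of j * FreeGroup.of l) = 2 := by
  have key : ∀ a b c : Fin n, a < b → b < c →
      trMod φ (FreeGroup.of a * FreeGroup.of b * FreeGroup.of c) = 2 := fun a b c h h' =>
    trMod_eq_two hφ (Ideal.subset_span (Or.inr ⟨a, b, c, h, h', rfl⟩))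
  have rot : ∀ a b c : Fin n, trMod φ (FreeGroup.of a * FreeGroup.of b * FreeGroup.of c) =
      trMod φ (FreeGroup.of b * FreeGroup.of c * FreeGroup.of a) := fun a b c => by
    rw [mul_assoc, trMod_mul_comm]
  have swap : ∀ a b c : Fin n, trMod φ (FreeGroup.of a * FreeGroup.of b * FreeGroup.of c) = 2 →
      trMod φ (FreeGroup.of b * FreeGroup.of a * FreeGroup.of c) = 2 := fun a b c h => by
    have h' := trMod_swap hφ a b c
    linear_combination h' - h
  have dup : ∀ a c : Fin n,
      trMod φ (FreeGroup.of a * FreeGroup.of a * FreeGroup.of c) = 2 := fun a c => by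
    have h := trMod_mul_inv φ (FreeGroup.of c * FreeGroup.of a) (FreeGroup.of a)
    rw [mul_inv_cancel_right, trMod_of hφ c, trMod_of hφ a, trMod_of_mul_of hφ, rot] at h
    linear_combination h
  rcases lt_trichotomy i j with h1 | rfl | h1
  · rcases lt_trichotomy j l with h2 | rfl | h2
    · exact key _ _ _ h1 h2
    · rw [rot]; exact dup _ _
    · rcases lt_trichotomy i l with h3 | rfl | h3
      · rw [rot, rot]; apply swap; exact key _ _ _ h3 h2
      · rw [rot, rot]; exact dup _ _
      · rw [rot, rot]; exact key _ _ _ h3 h1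
  · exact dup _ _
  · rcases lt_trichotomy j l with h2 | rfl | h2
    · rcases lt_trichotomy i l with h3 | rfl | h3
      · apply swap; exact key _ _ _ h1 h3
      · rw [rot, rot]; exact dup _ _
      · rw [rot]; exact key _ _ _ h2 h3
    · rw [rot]; exact dup _ _
    · rw [rot]; apply swap; exact key _ _ _ h2 h1

/-- A basis element or the inverse of one. -/
def IsLetter (a : FreeGroup (Fin n)) : Prop :=
  ∃ i : Fin n, a = FreeGroup.of i ∨ a = (FreeGroup.of i)⁻¹

theorem trMod_letter_mul_letter_mul_letter (hφ : ∀ f ∈ J n, φ f = 0)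
    {a b c : FreeGroup (Fin n)} (ha : IsLetter a)
    (hb : IsLetter b) (hc : IsLetter c) :
    trMod φ a = 2 ∧ trMod φ (a * b) = 2 ∧ trMod φ (a * b * c) = 2 := by
  have flip1 : ∀ g : FreeGroup (Fin n), trMod φ g = 2 → ∀ i, trMod φ (g * FreeGroup.of i) = 2 →
      trMod φ (g * (FreeGroup.of i)⁻¹) = 2 := fun g hg i h => by
    rw [trMod_mul_inv φ, hg, h, trMod_of hφ]
    ring
  have s1 : ∀ a : FreeGroup (Fin n), IsLetter a → trMod φ a = 2 := by
    rintro a ⟨i, rfl | rfl⟩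
    · exact trMod_of hφ i
    · simpa using flip1 1 (trMod_one φ) i (by simpa using trMod_of hφ i)
  have s2 : ∀ a b : FreeGroup (Fin n), IsLetter a → IsLetter b → trMod φ (a * b) = 2 := by
    have e : ∀ (a : FreeGroup (Fin n)) (i : Fin n), IsLetter a →
        trMod φ (a * FreeGroup.of i) = 2 := by
      rintro a j ⟨i, rfl | rfl⟩
      · exact trMod_of_mul_of hφ _ _
      · rw [trMod_mul_comm]
        exact flip1 _ (trMod_of hφ _) _ (trMod_of_mul_of hφ _ _)
    rintro a b ha ⟨i, rfl | rfl⟩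
    · exact e a i ha
    · exact flip1 _ (s1 a ha) _ (e a i ha)
  have e1 : ∀ (a : FreeGroup (Fin n)) (i j : Fin n), IsLetter a →
      trMod φ (a * FreeGroup.of i * FreeGroup.of j) = 2 := by
    rintro a j l ⟨i, rfl | rfl⟩
    · exact trMod_of_mul_of_mul_of hφ _ _ _
    · rw [mul_assoc, trMod_mul_comm]
      exact flip1 _ (trMod_of_mul_of hφ _ _) _ (trMod_of_mul_of_mul_of hφ _ _ _)
  have e2 : ∀ (a b : FreeGroup (Fin n)) (j : Fin n), IsLetter a → IsLetter b →
      trMod φ (a * b * FreeGroup.of j) = 2 := by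
    rintro a b l ha ⟨i, rfl | rfl⟩
    · exact e1 a i l ha
    · rw [trMod_mul_comm, ← mul_assoc]
      refine flip1 _ (s2 _ _ ⟨l, Or.inl rfl⟩ ha) _ ?_
      rw [mul_assoc, trMod_mul_comm]
      exact e1 a i l ha
  refine ⟨s1 a ha, s2 a b ha hb, ?_⟩
  obtain ⟨i, rfl | rfl⟩ := hc
  · exact e2 a b i ha hb
  · exact flip1 _ (s2 a b ha hb) _ (e2 a b i ha hb)

theorem trMod_list_prod [Algebra ℚ A] (hφ : ∀ f ∈ J n, φ f = 0)
    : ∀ (m : ℕ) (L : List (FreeGroup (Fin n))), L.length = m →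
    (∀ a ∈ L, IsLetter a) → trMod φ L.prod = 2 := by
  intro m
  induction m using Nat.strong_induction_on with
  | _ m ih =>
  intro L hL hl
  match L, hL, hl with
  | [], _, _ => simpa using trMod_one φ
  | [a], _, hl =>
    have ha := hl a (by simp)
    simpa using (trMod_letter_mul_letter_mul_letter hφ ha ha ha).1
  | [a, b], _, hl =>
    have ha := hl a (by simp)
    have hb := hl b (by simp)
    simpa using (trMod_letter_mul_letter_mul_letter hφ ha hb hb).2.1
  | [a, b, c], _, hl =>
    have ha := hl a (by simp)
    have hb := hl b (by simp)
    have hc := hl c (by simp)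
    simpa [mul_assoc] using (trMod_letter_mul_letter_mul_letter hφ ha hb hc).2.2
  | a :: b :: c :: d :: M, hL, hl =>
    have ha := hl a (by simp)
    have hb := hl b (by simp)
    have hc := hl c (by simp)
    have hw : ∀ x ∈ d :: M, IsLetter x := fun x hx => hl x (by simp at hx ⊢; tauto)
    simp only [List.length_cons] at hL
    have t : ∀ N : List (FreeGroup (Fin n)), N.length < m → (∀ x ∈ N, IsLetter x) →
        trMod φ N.prod = 2 := fun N hN h => ih _ hN N rfl h
    have habc := trMod_letter_mul_letter_mul_letter hφ ha hb hc
    have hbca := trMod_letter_mul_letter_mul_letter hφ hb hc ha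
    have hac := trMod_letter_mul_letter_mul_letter hφ ha hc hb
    have hc1 := (trMod_letter_mul_letter_mul_letter hφ hc ha hb).1
    generalize hwd : d :: M = w at hw
    have hlen : w.length + 3 = m := by rw [← hwd, ← hL]; simp
    have hprod : (a :: b :: c :: w).prod = a * b * c * w.prod := by simp [mul_assoc]
    have l1 : trMod φ w.prod = 2 := t w (by omega) hw
    have l2 : ∀ x, IsLetter x → trMod φ (x * w.prod) = 2 := fun x hx => by
      have := t (x :: w) (by simp; omega) (by simpa using ⟨hx, hw⟩)
      simpa using this
    have l3 : ∀ x y, IsLetter x → IsLetter y → trMod φ (x * y * w.prod) = 2 := fun x y hx hy => by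
      have := t (x :: y :: w) (by simp; omega) (by simpa using ⟨hx, hy, hw⟩)
      simpa [mul_assoc] using this
    rw [hprod]
    have key := congrArg φ (two_mul_tr a b c w.prod)
    simp only [map_sub, map_add, map_mul] at key
    have r1 : trMod φ (c * w.prod * a) = 2 := by
      rw [trMod_mul_comm, ← mul_assoc]; exact l3 a c ha hc
    have r2 : trMod φ (w.prod * a * b) = 2 := by
      rw [mul_assoc, trMod_mul_comm]; exact l3 a b ha hb
    change _ * trMod φ _ = trMod φ _ * trMod φ _ + trMod φ _ * trMod φ _ + trMod φ _ * trMod φ _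
      + trMod φ _ * trMod φ _ + trMod φ _ * trMod φ _ - trMod φ _ * trMod φ _ + trMod φ _ * trMod φ _
      - trMod φ _ * trMod φ _ * trMod φ _ - trMod φ _ * trMod φ _ * trMod φ _ - trMod φ _ * trMod φ _ * trMod φ _
      - trMod φ _ * trMod φ _ * trMod φ _ + trMod φ _ * trMod φ _ * trMod φ _ * trMod φ _ at key
    rw [r1, r2, habc.1, hbca.1, hc1, l1, habc.2.1, habc.2.2, hbca.2.1, hac.2.1, l2 a ha, l2 b hb,
      l2 c hc, l3 b c hb hc] at key
    rw [map_ofNat] at key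
    have h2 : (2 : A) * trMod φ (a * b * c * w.prod) = 2 * 2 := by
      linear_combination key
    have hu : IsUnit (2 : A) := by
      have := (IsUnit.mk0 (2 : ℚ) two_ne_zero).map (algebraMap ℚ A)
      rwa [map_ofNat] at this
    exact hu.mul_left_cancel h2

theorem tr'_mem_J (x : FreeGroup (Fin n)) : tr' x ∈ J n := by
  have h : ∃ L : List (FreeGroup (Fin n)), (∀ a ∈ L, IsLetter a) ∧ L.prod = x := by
    induction x using FreeGroup.induction_on with
    | C1 => exact ⟨[], by simp, by simp⟩
    | of i => exact ⟨[FreeGroup.of i], by simpa using ⟨i, Or.inl rfl⟩, by simp⟩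
    | inv_of i _ => exact ⟨[(FreeGroup.of i)⁻¹], by simpa using ⟨i, Or.inr rfl⟩, by simp⟩
    | mul x y hx hy =>
      obtain ⟨L, hL, rfl⟩ := hx
      obtain ⟨M, hM, rfl⟩ := hy
      refine ⟨L ++ M, ?_, by simp⟩
      intro a ha
      rcases List.mem_append.1 ha with h | h
      · exact hL a h
      · exact hM a h
  obtain ⟨L, hL, rfl⟩ := h
  have h := trMod_list_prod (φ := Ideal.Quotient.mk (J n))
    (fun f hf => Ideal.Quotient.eq_zero_iff_mem.2 hf) _ L rfl hL
  rw [← Ideal.Quotient.eq_zero_iff_mem, tr', map_sub, map_ofNat, sub_eq_zero]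
  exact h

/-- `J` is generated by all the `tr' x`, `x ∈ F_n`. -/
theorem J_eq_span (n : ℕ) : J n = Ideal.span (Set.range (tr' (G := FreeGroup (Fin n)))) := by
  apply le_antisymm
  · refine Ideal.span_mono ?_
    rintro _ ((⟨i, rfl⟩ | ⟨i, j, _, rfl⟩) | ⟨i, j, l, _, _, rfl⟩)
    all_goals exact ⟨_, rfl⟩
  · rw [Ideal.span_le]
    rintro _ ⟨x, rfl⟩
    exact tr'_mem_J x

/-- The powers of `J` are invariant under `Aut F_n`. -/
theorem action_mem_J_pow (σ : MulAut (FreeGroup (Fin n))) (m : ℕ)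
    {f : CharRing (FreeGroup (Fin n))} (hf : f ∈ J n ^ m) : action σ f ∈ J n ^ m := by
  have h1 : (J n).map (action σ) ≤ J n := by
    conv_lhs => rw [J_eq_span]
    rw [Ideal.map_span, Ideal.span_le]
    rintro _ ⟨_, ⟨x, rfl⟩, rfl⟩
    rw [action_tr']
    exact tr'_mem_J _
  have h2 := Ideal.mem_map_of_mem (action σ) hf
  rw [Ideal.map_pow] at h2
  exact Ideal.pow_right_mono h1 m h2

end Invariance

/-- The `ℚ`-vector space `gr^k(J) = J^k / J^{k+1}`. -/
abbrev grJ (n k : ℕ) : Type :=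
  ↥((J n ^ k).restrictScalars ℚ) ⧸
    ((J n ^ (k + 1)).restrictScalars ℚ).submoduleOf ((J n ^ k).restrictScalars ℚ)

/-! ### The filtration of the automorphism group of a free group -/

/-- `𝓔(k)`: the subgroup of those automorphisms of `F_n` that act trivially on `J / J^{k+1}`. -/
def E (n k : ℕ) : Subgroup (MulAut (FreeGroup (Fin n))) where
  carrier := {σ | ∀ f ∈ J n, action σ f - f ∈ J n ^ (k + 1)}
  one_mem' := fun f _ => by simp
  mul_mem' := fun {σ τ} hσ hτ f hf => by
    have h := add_mem (action_mem_J_pow σ _ (hτ f hf)) (hσ f hf)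
    have e : action (σ * τ) f - f = action σ (action τ f - f) + (action σ f - f) := by
      rw [map_mul, map_sub, AlgHom.mul_apply]
      ring
    rwa [e]
  inv_mem' := fun {σ} hσ f hf => by
    have h := neg_mem (action_mem_J_pow σ⁻¹ _ (hσ f hf))
    have e : action σ⁻¹ (action σ f) = f := by
      rw [← AlgHom.mul_apply, ← map_mul, inv_mul_cancel, map_one, AlgHom.one_apply]
    rw [map_sub, e] at h
    simpa using h

theorem E_succ_le (n k : ℕ) : E n (k + 1) ≤ E n k :=
  fun _ hσ f hf => Ideal.pow_le_pow_right (by omega) (hσ f hf)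

instance E_normal (n k : ℕ) : (E n k).Normal where
  conj_mem σ hσ τ f hf := by
    have e : action τ (action τ⁻¹ f) = f := by
      rw [← AlgHom.mul_apply, ← map_mul, mul_inv_cancel, map_one, AlgHom.one_apply]
    have h0 : action τ⁻¹ f ∈ J n := by
      simpa using action_mem_J_pow τ⁻¹ 1 (by simpa using hf)
    have h := action_mem_J_pow τ _ (hσ _ h0)
    rw [map_sub, e] at h
    simpa only [map_mul, AlgHom.mul_apply] using h

/-- The group `gr^k(𝓔) = 𝓔(k) / 𝓔(k+1)`. -/
abbrev grE (n k : ℕ) : Type := ↥(E n k) ⧸ (E n (k + 1)).subgroupOf (E n k)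

/-- An element of `𝓔(k)` moves elements of `J^{m+1}` by elements of `J^{m+k+1}`. -/
theorem action_sub_mem {n k : ℕ} {σ : MulAut (FreeGroup (Fin n))} (hσ : σ ∈ E n k) (m : ℕ) :
    ∀ f ∈ J n ^ (m + 1), action σ f - f ∈ J n ^ (m + k + 1) := by
  induction m with
  | zero =>
    intro f hf
    simpa using hσ f (by simpa using hf)
  | succ m ih =>
    intro f hf
    rw [pow_succ] at hf
    induction hf using Submodule.mul_induction_on' with
    | mem_mul_mem a ha b hb =>
      have h1 := Ideal.mul_mem_mul (ih a ha)
        (by simpa using action_mem_J_pow σ 1 (by simpa using hb) : action σ b ∈ J n)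
      have h2 := Ideal.mul_mem_mul ha (hσ b hb)
      rw [← pow_succ] at h1
      rw [← pow_add] at h2
      have e : action σ (a * b) - a * b =
          (action σ a - a) * action σ b + a * (action σ b - b) := by
        rw [map_mul]
        ring
      rw [e]
      refine add_mem ?_ ?_
      · convert h1 using 2
        omega
      · convert h2 using 2
        omega
    | add a _ b _ ha hb =>
      have e : action σ (a + b) - (a + b) = (action σ a - a) + (action σ b - b) := by
        rw [map_add]
        ring
      rw [e]
      exact add_mem ha hb

/-! ### The homomorphism `η_k` -/

/-- For `σ ∈ 𝓔(k)`, the linear map `J → J^{k+1}`, `f ↦ σ f - f`. -/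
def etaAux (n k : ℕ) (σ : E n k) :
    ↥((J n ^ 1).restrictScalars ℚ) →ₗ[ℚ] ↥((J n ^ (k + 1)).restrictScalars ℚ) :=
  LinearMap.restrict ((action σ.1).toLinearMap - LinearMap.id)
    (fun f hf => σ.2 f (by simpa using hf))

/-- For `σ ∈ 𝓔(k)`, the linear map `gr^1(J) → gr^{k+1}(J)` sending the class of `f` to the class
of `σ f - f`. -/
def etaMap (n k : ℕ) (σ : E n k) : grJ n 1 →ₗ[ℚ] grJ n (k + 1) :=
  Submodule.mapQ _ _ (etaAux n k σ) (by
    rintro ⟨f, _⟩ hf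
    have hf' : f ∈ J n ^ (1 + 1) := hf
    have h := action_sub_mem σ.2 1 f hf'
    change action σ.1 f - f ∈ J n ^ (k + 1 + 1)
    convert h using 2
    omega)

/-- The homomorphism `η_k : gr^k(𝓔) → Hom_ℚ(gr^1(J), gr^{k+1}(J))` for `k ≥ 1`, sending the class
of `σ` to `[f] ↦ [σ f - f]`. (`Multiplicative` only records that the target is regarded as a
group under addition.) -/
def eta (n k : ℕ) (hk : 1 ≤ k) :
    grE n k →* Multiplicative (grJ n 1 →ₗ[ℚ] grJ n (k + 1)) :=
  QuotientGroup.lift _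
    (MonoidHom.mk' (fun σ : E n k => Multiplicative.ofAdd (etaMap n k σ)) (by
      intro σ τ
      change etaMap n k (σ * τ) = etaMap n k σ + etaMap n k τ
      apply Submodule.linearMap_qext
      ext1 ⟨f, hf⟩
      refine (Submodule.Quotient.eq _).2 ?_
      change (action (σ.1 * τ.1) f - f) - ((action σ.1 f - f) + (action τ.1 f - f)) ∈
        J n ^ (k + 1 + 1)
      have hf' : f ∈ J n := by simpa using hf
      have h := action_sub_mem σ.2 k _ (τ.2 f hf')
      have e : (action (σ.1 * τ.1) f - f) - ((action σ.1 f - f) + (action τ.1 f - f)) =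
          action σ.1 (action τ.1 f - f) - (action τ.1 f - f) := by
        rw [map_mul, map_sub, AlgHom.mul_apply]
        ring
      rw [e]
      exact Ideal.pow_le_pow_right (by omega) h))
    (by
      intro σ hσ
      change etaMap n k σ = 0
      apply Submodule.linearMap_qext
      ext1 ⟨f, hf⟩
      refine (Submodule.Quotient.mk_eq_zero _).2 ?_
      exact (Subgroup.mem_subgroupOf.1 hσ) f (by simpa using hf))

/-- The image of the `ℚ`-linear extension `gr^k(𝓔) ⊗ ℚ → Hom_ℚ(gr^1(J), gr^{k+1}(J))` of `η_k`,
that is, the `ℚ`-span of the image of `η_k`. -/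
def etaImage (n k : ℕ) (hk : 1 ≤ k) : Submodule ℚ (grJ n 1 →ₗ[ℚ] grJ n (k + 1)) :=
  Submodule.span ℚ (Set.range fun s : grE n k => Multiplicative.toAdd (eta n k hk s))

/-- The cokernel of `η_k` as a `ℚ`-vector space. -/
abbrev etaCoker (n k : ℕ) (hk : 1 ≤ k) : Type :=
  (grJ n 1 →ₗ[ℚ] grJ n (k + 1)) ⧸ etaImage n k hk

end Fricke

end

/-! Restrict Fricke characters to the diagonal representations x_i ↦ diag(exp(a_i X), exp(-a_i X)),
with a_1, ..., a_n independent variables. There tr x becomes 2 cosh(ℓ(x) X), where ℓ is the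
abelianization map sending x_i to a_i. So J^m lands in X^(2m), and leading coefficients map gr^m(J)
onto the homogeneous polynomials of degree 2m in the a_i. If σ acts trivially on J/J^2, then
comparing X^2-coefficients gives ℓ(σ x)^2 = ℓ(x)^2, hence ℓ(σ x) = ±ℓ(x). As cosh is even, σ does
not change the restriction at all (`exists_diagonal_expansion`). Composing with gr^(k+1)(J) →
Sym^(2k+2) therefore kills the image of η_k, and the cokernel maps onto Hom(gr^1(J), Sym^(2k+2)).
Two counts finish the proof. The n + C(n,2) + C(n,3) generators are independent in gr^1(J)
(`linearIndependent_wordClass`), by specialization to products of unipotent matrices. The monomials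
of degree 2k+2, sorted by their number 2l of odd exponents, give the sum in the bound. Characters
live on SL(2, ℂ), so power series representations are reached by embedding the power series ring
abstractly in ℂ. -/

/-! ### Specialization of characters along representations over domains embedded in ℂ -/

open Cardinal in
/-- A domain of characteristic zero whose cardinality is that of the continuum embeds in `ℂ`. -/
theorem exists_injective_ringHom_complex (R : Type) [CommRing R] [IsDomain R] [CharZero R]
    (hR : #R = 𝔠) : ∃ f : R →+* ℂ, Function.Injective f := by
  have : CharZero (AlgebraicClosure (FractionRing R)) :=
    charZero_of_injective_algebraMap
      (FaithfulSMul.algebraMap_injective (FractionRing R) (AlgebraicClosure (FractionRing R)))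
  have hinj : Function.Injective (algebraMap R (AlgebraicClosure (FractionRing R))) := by
    rw [IsScalarTower.algebraMap_eq R (FractionRing R)]
    exact (FaithfulSMul.algebraMap_injective (FractionRing R) _).comp
      (IsFractionRing.injective R (FractionRing R))
  have hcard : #(AlgebraicClosure (FractionRing R)) = 𝔠 := by
    apply le_antisymm
    · refine (Algebra.IsAlgebraic.cardinalMk_le_max (FractionRing R) _).trans ?_
      rw [FractionRing.cardinalMk, hR]
      exact max_le le_rfl aleph0_le_continuum
    · rw [← hR]
      exact mk_le_of_injective hinj
  -- Steinitz: uncountable algebraically closed fields of characteristic zero with the same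
  -- cardinality are isomorphic.
  obtain ⟨e⟩ := IsAlgClosed.ringEquiv_of_equiv_of_charZero
    (K := AlgebraicClosure (FractionRing R)) (L := ℂ) (hcard ▸ aleph0_lt_continuum)
    (Cardinal.eq.1 (hcard.trans mk_complex.symm))
  exact ⟨(e : AlgebraicClosure (FractionRing R) →+* ℂ).comp (algebraMap R _), e.injective.comp hinj⟩

open Cardinal in
-- Supplies the cardinality needed to embed the power series ring in ℂ.
theorem mk_powerSeries_eq_continuum (A : Type) [Countable A] [Infinite A] :
    #(PowerSeries A) = 𝔠 := by
  change #((Unit →₀ ℕ) → A) = 𝔠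
  rw [← power_def, mk_eq_aleph0 A, mk_eq_aleph0 (Unit →₀ ℕ), aleph0_power_aleph0]

namespace Fricke

/-- A representation of `G` over a domain of characteristic zero that embeds in `ℂ` defines a
specialization of the ring of Fricke characters. -/
theorem exists_algHom_tr {G : Type*} [Group G] {R : Type} [CommRing R] [IsDomain R] [CharZero R]
    [Algebra ℚ R] (hR : Cardinal.mk R = Cardinal.continuum) (ρ : G →* SL(2, R)) :
    ∃ Φ : CharRing G →ₐ[ℚ] R, ∀ x, Φ (tr x) = (ρ x).1.trace := by
  obtain ⟨ι, hι⟩ := exists_injective_ringHom_complex R hR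
  let ι' : R →ₐ[ℚ] ℂ := ι.toRatAlgHom
  let ρ' : G →* SL(2, ℂ) := (Matrix.SpecialLinearGroup.map ι).comp ρ
  let ev : CharRing G →ₐ[ℚ] ℂ :=
    (Pi.evalAlgHom ℚ (fun _ : G →* SL(2, ℂ) => ℂ) ρ').comp (subalgebra G).val
  have hev : ∀ x, ev (tr x) = ι' (ρ x).1.trace := by
    intro x
    change Matrix.trace (ρ' x : Matrix (Fin 2) (Fin 2) ℂ) = ι (ρ x).1.trace
    simp [ρ', Matrix.trace_fin_two]
  -- The characters span, and their values at `ρ'` come from `R`, so evaluation factors through the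
  -- image of `ι'` and can be pulled back to `R`.
  have hmem : ∀ f : CharRing G, ev f ∈ ι'.range := by
    rintro ⟨f, hf⟩
    change f ∈ Submodule.span ℚ (Set.range (charFun (G := G))) at hf
    change f ρ' ∈ ι'.range
    induction hf using Submodule.span_induction with
    | mem f hf =>
      obtain ⟨x, rfl⟩ := hf
      exact ⟨_, (hev x).symm⟩
    | zero => exact zero_mem _
    | add f g _ _ hf hg => exact add_mem hf hg
    | smul c f _ hf => exact Subalgebra.smul_mem _ hf c
  refine ⟨((AlgEquiv.ofInjective ι' hι).symm : _ →ₐ[ℚ] R).comp (ev.codRestrict ι'.range hmem),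
    fun x => ?_⟩
  apply hι
  change ι' ((AlgEquiv.ofInjective ι' hι).symm _) = ι' _
  rw [← hev, ← AlgEquiv.ofInjective_apply ι' hι, AlgEquiv.apply_symm_apply]
  rfl

/-- An algebra homomorphism out of the ring of Fricke characters is determined by its values on
the characters. -/
theorem algHom_ext_tr {G : Type*} [Group G] {R : Type*} [CommRing R] [Algebra ℚ R]
    {Φ Ψ : CharRing G →ₐ[ℚ] R} (h : ∀ x, Φ (tr x) = Ψ (tr x)) : Φ = Ψ := by
  apply AlgHom.ext
  rintro ⟨f, hf⟩
  have key : ∀ f ∈ Submodule.span ℚ (Set.range (charFun (G := G))),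
      ∃ hf : f ∈ subalgebra G, Φ ⟨f, hf⟩ = Ψ ⟨f, hf⟩ := by
    intro f hf
    induction hf using Submodule.span_induction with
    | mem f hf =>
      obtain ⟨x, rfl⟩ := hf
      exact ⟨(tr x).2, h x⟩
    | zero => exact ⟨zero_mem _, (map_zero Φ).trans (map_zero Ψ).symm⟩
    | add f g _ _ hf hg =>
      obtain ⟨⟨hf, ef⟩, ⟨hg, eg⟩⟩ := And.intro hf hg
      exact ⟨add_mem hf hg, (map_add Φ ⟨f, hf⟩ ⟨g, hg⟩).trans
        ((congrArg₂ _ ef eg).trans (map_add Ψ _ _).symm)⟩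
    | smul c f _ hf =>
      obtain ⟨hf, ef⟩ := hf
      exact ⟨Subalgebra.smul_mem _ hf c, (map_smul Φ c ⟨f, hf⟩).trans
        ((congrArg _ ef).trans (map_smul Ψ c _).symm)⟩
  exact (key f hf).2

/-! ### Representations over power series that are trivial modulo X -/

open PowerSeries

/-- If a matrix in `SL₂` is congruent to `1` modulo `X`, then its trace is congruent to `2`
modulo `X ^ 2`. -/
theorem X_sq_dvd_trace_sub_two {A : Type*} [CommRing A] (M : SL(2, A⟦X⟧))
    (hM : Matrix.SpecialLinearGroup.map (constantCoeff (R := A)) M = 1) :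
    (X : A⟦X⟧) ^ 2 ∣ M.1.trace - 2 := by
  have hdet : M.1 0 0 * M.1 1 1 - M.1 0 1 * M.1 1 0 = 1 := by
    rw [← Matrix.det_fin_two, M.2]
  have h (i j) : constantCoeff (M.1 i j) = (1 : Matrix (Fin 2) (Fin 2) A) i j :=
    congrFun (congrFun (congrArg Subtype.val hM) i) j
  obtain ⟨a, ha⟩ : (X : A⟦X⟧) ∣ M.1 0 0 - 1 := X_dvd_iff.2 (by simp [h])
  obtain ⟨d, hd⟩ : (X : A⟦X⟧) ∣ M.1 1 1 - 1 := X_dvd_iff.2 (by simp [h])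
  obtain ⟨b, hb⟩ : (X : A⟦X⟧) ∣ M.1 0 1 := X_dvd_iff.2 (by simp [h])
  obtain ⟨c, hc⟩ : (X : A⟦X⟧) ∣ M.1 1 0 := X_dvd_iff.2 (by simp [h])
  rw [Matrix.trace_fin_two]
  rw [sub_eq_iff_eq_add] at ha hd
  rw [ha, hb, hc, hd] at hdet
  rw [ha, hd]
  -- Write the matrix as 1 + XN. Determinant 1 means X tr N + X^2 det N = 0, so the trace minus 2
  -- equals -X^2 det N.
  exact ⟨b * c - a * d, by linear_combination hdet⟩

/-- Specialization along a representation over a power series ring that is trivial modulo `X`. -/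
theorem exists_algHom_powerSeries {n : ℕ} {A : Type} [CommRing A] [IsDomain A] [Algebra ℚ A]
    [Countable A] (M : Fin n → SL(2, A⟦X⟧))
    (hM : ∀ i, Matrix.SpecialLinearGroup.map (constantCoeff (R := A)) (M i) = 1) :
    ∃ Φ : CharRing (FreeGroup (Fin n)) →ₐ[ℚ] A⟦X⟧,
      (∀ x, Φ (tr x) = (FreeGroup.lift M x).1.trace) ∧
      ∀ m, ∀ f ∈ J n ^ m, (X : A⟦X⟧) ^ (2 * m) ∣ Φ f := by
  have : CharZero A := algebraRat.charZero A
  have : CharZero A⟦X⟧ := algebraRat.charZero _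
  have : Infinite A := CharZero.infinite A
  obtain ⟨Φ, hΦ⟩ := exists_algHom_tr (mk_powerSeries_eq_continuum A) (FreeGroup.lift M)
  refine ⟨Φ, hΦ, fun m f hf => ?_⟩
  have hJ : J n ≤ (Ideal.span {(X : A⟦X⟧) ^ 2}).comap Φ := by
    rw [J_eq_span, Ideal.span_le]
    rintro _ ⟨x, rfl⟩
    change Φ (tr' x) ∈ Ideal.span {(X : A⟦X⟧) ^ 2}
    rw [Ideal.mem_span_singleton, tr', map_sub, map_ofNat, hΦ]
    apply X_sq_dvd_trace_sub_two
    have : (Matrix.SpecialLinearGroup.map (constantCoeff (R := A))).comp (FreeGroup.lift M) = 1 :=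
      FreeGroup.ext_hom _ _ fun i => by simpa using hM i
    exact DFunLike.congr_fun this x
  have h := Ideal.le_comap_pow Φ m (Ideal.pow_right_mono hJ m hf)
  rwa [Ideal.mem_comap, Ideal.span_singleton_pow, Ideal.mem_span_singleton, ← pow_mul] at h

/-! ### Diagonal representations -/

/-- The homomorphism `a ↦ diag(exp (aX), exp (-aX))`. -/
noncomputable def expTorus (A : Type*) [CommRing A] [Algebra ℚ A] :
    Multiplicative A →* SL(2, A⟦X⟧) where
  toFun a := ⟨!![rescale a.toAdd (exp A), 0; 0, rescale (-a.toAdd) (exp A)], by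
    rw [Matrix.det_fin_two_of, exp_mul_exp_eq_exp_add]
    simp⟩
  map_one' := by
    ext i j : 2
    fin_cases i <;> fin_cases j <;> simp
  map_mul' a b := by
    apply Subtype.ext
    change !![rescale (a * b).toAdd (exp A), 0; 0, rescale (-(a * b).toAdd) (exp A)] =
      !![rescale a.toAdd (exp A), 0; 0, rescale (-a.toAdd) (exp A)] *
        !![rescale b.toAdd (exp A), 0; 0, rescale (-b.toAdd) (exp A)]
    rw [Matrix.mul_fin_two]
    simp only [exp_mul_exp_eq_exp_add, toAdd_mul, mul_zero, zero_mul, add_zero, zero_add, neg_add]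

theorem trace_expTorus {A : Type*} [CommRing A] [Algebra ℚ A] (a : Multiplicative A) :
    (expTorus A a).1.trace = rescale a.toAdd (exp A) + rescale (-a.toAdd) (exp A) := by
  rw [Matrix.trace_fin_two]
  rfl

theorem coeff_two_trace_expTorus {A : Type*} [CommRing A] [Algebra ℚ A] (a : Multiplicative A) :
    coeff 2 (expTorus A a).1.trace = a.toAdd ^ 2 := by
  have h : algebraMap ℚ A (1 / 2) + algebraMap ℚ A (1 / 2) = 1 := by
    rw [← map_add]
    norm_num
  rw [trace_expTorus, map_add, coeff_rescale, coeff_rescale, coeff_exp]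
  simp only [Nat.factorial_two, Nat.cast_ofNat]
  linear_combination (a.toAdd ^ 2) * h

theorem constantCoeff_expTorus {A : Type*} [CommRing A] [Algebra ℚ A] (a : Multiplicative A) :
    Matrix.SpecialLinearGroup.map (constantCoeff (R := A)) (expTorus A a) = 1 := by
  have h (b : A) : constantCoeff (rescale b (exp A)) = 1 := by
    rw [← coeff_zero_eq_constantCoeff_apply, coeff_rescale]
    simp
  apply Subtype.ext
  change (!![rescale a.toAdd (exp A), 0; 0, rescale (-a.toAdd) (exp A)]).map constantCoeff = 1
  ext i j
  fin_cases i <;> fin_cases j <;> simp [h]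

/-- Only the lowest terms contribute. This makes leading coefficients multiplicative along the
powers of J. -/
theorem coeff_add_mul_of_X_pow_dvd {A : Type*} [CommRing A] {a b : ℕ} {p q : A⟦X⟧}
    (hp : (X : A⟦X⟧) ^ a ∣ p) (hq : (X : A⟦X⟧) ^ b ∣ q) :
    coeff (a + b) (p * q) = coeff a p * coeff b q := by
  obtain ⟨p, rfl⟩ := hp
  obtain ⟨q, rfl⟩ := hq
  have e : (X : A⟦X⟧) ^ a * p * (X ^ b * q) = X ^ (a + b) * (p * q) := by ring
  have h (m : ℕ) (r : A⟦X⟧) : coeff m (X ^ m * r) = coeff 0 r := by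
    simpa using coeff_X_pow_mul r m 0
  rw [e, h, h, h]
  simp

/-- The restriction of Fricke characters to diagonal representations, expanded at the trivial
representation. It is invariant under automorphisms that act trivially on `J / J ^ 2`, and the
leading terms of elements of `J ^ m` exhaust the monomials of degree `2 * m`. -/
theorem exists_diagonal_expansion (n : ℕ) :
    ∃ Φ : CharRing (FreeGroup (Fin n)) →ₐ[ℚ] (MvPolynomial (Fin n) ℚ)⟦X⟧,
      (∀ m, ∀ f ∈ J n ^ m, X ^ (2 * m) ∣ Φ f) ∧
      (∀ σ ∈ E n 1, ∀ f, Φ (action σ f) = Φ f) ∧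
      ∀ m, ∀ d : Fin n →₀ ℕ, d.degree = 2 * m →
        ∃ f ∈ J n ^ m, coeff (2 * m) (Φ f) = MvPolynomial.monomial d 1 := by
  let A := MvPolynomial (Fin n) ℚ
  let ℓ : FreeGroup (Fin n) →* Multiplicative A :=
    FreeGroup.lift fun i => Multiplicative.ofAdd (MvPolynomial.X i)
  have : Countable A := Cardinal.mk_le_aleph0_iff.1
    ((MvPolynomial.cardinalMk_le_max (σ := Fin n) (R := ℚ)).trans (by simp))
  obtain ⟨Φ, hΦ, hdvd⟩ := exists_algHom_powerSeries
    (fun i : Fin n => expTorus A (Multiplicative.ofAdd (MvPolynomial.X i)))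
    fun i => constantCoeff_expTorus _
  have hℓ : FreeGroup.lift (fun i : Fin n => expTorus A (Multiplicative.ofAdd (MvPolynomial.X i)))
      = (expTorus A).comp ℓ := FreeGroup.ext_hom _ _ fun i => by simp [ℓ]
  rw [hℓ] at hΦ
  have hΦ2 (x) : coeff 2 (Φ (tr' x)) = (ℓ x).toAdd ^ 2 := by
    rw [tr', map_sub, map_ofNat, hΦ, map_sub, MonoidHom.comp_apply, coeff_two_trace_expTorus]
    have : coeff 2 (2 : A⟦X⟧) = 0 := by
      rw [← map_ofNat (C (R := A)) 2, coeff_C]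
      simp
    rw [this, sub_zero]
  refine ⟨Φ, hdvd, fun σ hσ f => ?_, ?_⟩
  · suffices h : Φ.comp (action σ) = Φ from DFunLike.congr_fun h f
    refine algHom_ext_tr fun x => ?_
    -- σ(tr' x) - tr' x lies in J^2, so its expansion starts at X^4 and its X^2-coefficient ℓ(σ x)^2
    -- - ℓ(x)^2 vanishes.
    have h := X_pow_dvd_iff.1 (hdvd 2 _ (hσ (tr' x) (tr'_mem_J x))) 2 (by norm_num)
    rw [action_tr', map_sub, map_sub, hΦ2, hΦ2, sub_eq_zero, sq_eq_sq_iff_eq_or_eq_neg] at h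
    change Φ (tr (σ x)) = Φ (tr x)
    rw [hΦ, hΦ, MonoidHom.comp_apply, MonoidHom.comp_apply, trace_expTorus, trace_expTorus]
    -- The sign may depend on x, but the trace is even in ℓ(x).
    rcases h with h | h
    · rw [h]
    · rw [h, neg_neg, add_comm]
  -- Polarization: a_i a_j = ((a_i + a_j)^2 - a_i^2 - a_j^2) / 2.
  · have hpair (i j : Fin n) : ∃ f ∈ J n, coeff 2 (Φ f) = MvPolynomial.X i * MvPolynomial.X j := by
      refine ⟨(1 / 2 : ℚ) • (tr' (FreeGroup.of i * FreeGroup.of j) - tr' (FreeGroup.of i)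
        - tr' (FreeGroup.of j)), ?_, ?_⟩
      · exact Submodule.smul_of_tower_mem _ _ (sub_mem (sub_mem (tr'_mem_J _) (tr'_mem_J _))
          (tr'_mem_J _))
      · have hc (c : ℚ) (p : A⟦X⟧) : coeff 2 (c • p) = c • coeff 2 p := rfl
        rw [map_smul, map_sub, map_sub, hc, map_sub, map_sub, hΦ2, hΦ2, hΦ2, map_mul]
        simp only [ℓ, FreeGroup.lift_apply_of, toAdd_mul, toAdd_ofAdd]
        rw [one_div, inv_smul_eq_iff₀ two_ne_zero, ofNat_smul_eq_nsmul, two_nsmul]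
        ring
    intro m
    induction m with
    | zero =>
      intro d hd
      have : d = 0 := by simpa [Finsupp.degree_eq_zero_iff] using hd
      exact ⟨1, by simp, by simp [this]⟩
    | succ m ih =>
      intro d hd
      -- Two variables are split off the monomial and realized by one element of J from `hpair`.
      have hex (e : Fin n →₀ ℕ) (he : e.degree ≠ 0) :
          ∃ i e', e = e' + Finsupp.single i 1 := by
        have he : e ≠ 0 := by rwa [Ne, ← Finsupp.degree_eq_zero_iff]
        obtain ⟨i, hi⟩ := Finsupp.ne_iff.1 he
        refine ⟨i, e - Finsupp.single i 1, (tsub_add_cancel_of_le ?_).symm⟩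
        rw [Finsupp.single_le_iff]
        exact Nat.one_le_iff_ne_zero.2 hi
      obtain ⟨i, d, rfl⟩ := hex d (by omega)
      rw [map_add, Finsupp.degree_single] at hd
      obtain ⟨j, d, rfl⟩ := hex d (by omega)
      rw [map_add, Finsupp.degree_single] at hd
      obtain ⟨f, hf, hf'⟩ := ih d (by omega)
      obtain ⟨g, hg, hg'⟩ := hpair j i
      refine ⟨f * g, pow_succ (J n) m ▸ Ideal.mul_mem_mul hf hg, ?_⟩
      have := coeff_add_mul_of_X_pow_dvd (hdvd _ f hf) (hdvd 1 g (by simpa using hg))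
      have hmon : (MvPolynomial.monomial (d + Finsupp.single j 1 + Finsupp.single i 1) 1 :
          MvPolynomial (Fin n) ℚ) =
            MvPolynomial.monomial d 1 * (MvPolynomial.X j * MvPolynomial.X i) := by
        simp [MvPolynomial.X, MvPolynomial.monomial_mul, add_assoc]
      rw [map_mul, mul_add_one, this, hf', hg', hmon]

/-- A coefficient of an expansion of Fricke characters, as a functional on `gr^m(J)`. -/
theorem exists_linearMap_grJ {n : ℕ} {A : Type} [CommRing A] [Algebra ℚ A]
    {Φ : CharRing (FreeGroup (Fin n)) →ₐ[ℚ] A⟦X⟧}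
    (hΦ : ∀ m, ∀ f ∈ J n ^ m, (X : A⟦X⟧) ^ (2 * m) ∣ Φ f) (m d : ℕ) (hd : d < 2 * (m + 1)) :
    ∃ Λ : grJ n m →ₗ[ℚ] A, ∀ f, Λ (Submodule.Quotient.mk f) = coeff d (Φ f.1) := by
  refine ⟨Submodule.liftQ _ (((coeff d).restrictScalars ℚ ∘ₗ Φ.toLinearMap) ∘ₗ
    Submodule.subtype _) ?_, fun f => rfl⟩
  intro f hf
  exact X_pow_dvd_iff.1 (hΦ (m + 1) f.1 hf) d hd

/-! ### Linear independence of the generators in gr^1(J) -/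

/-- All entries of a matrix of power series are polynomials of degree at most `d`. -/
def EntryDegreeLE {A : Type*} [CommRing A] (d : ℕ) (B : Matrix (Fin 2) (Fin 2) A⟦X⟧) : Prop :=
  ∀ i j m, d < m → coeff m (B i j) = 0

theorem EntryDegreeLE.mul {A : Type*} [CommRing A] {d e : ℕ} {B C : Matrix (Fin 2) (Fin 2) A⟦X⟧}
    (hB : EntryDegreeLE d B) (hC : EntryDegreeLE e C) : EntryDegreeLE (d + e) (B * C) := by
  intro i j m hm
  rw [Matrix.mul_apply, map_sum]
  refine Finset.sum_eq_zero fun l _ => ?_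
  rw [coeff_mul]
  refine Finset.sum_eq_zero fun p hp => ?_
  have hp := Finset.HasAntidiagonal.mem_antidiagonal.1 hp
  rcases lt_or_ge d p.1 with h | h
  · rw [hB i l _ h, zero_mul]
  · rw [hC l j _ (by omega), mul_zero]

theorem entryDegreeLE_one {A : Type*} [CommRing A] :
    EntryDegreeLE 0 (1 : Matrix (Fin 2) (Fin 2) A⟦X⟧) := by
  intro i j m hm
  rw [Matrix.one_apply]
  split_ifs
  · rw [coeff_one, if_neg (by omega)]
  · exact map_zero _

theorem entryDegreeLE_list_prod {A ι : Type*} [CommRing A] {M : ι → SL(2, A⟦X⟧)} {d : ι → ℕ}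
    (hM : ∀ i, EntryDegreeLE (d i) (M i).1) (L : List ι) :
    EntryDegreeLE (L.map d).sum (L.map M).prod.1 := by
  induction L with
  | nil => exact entryDegreeLE_one
  | cons i L ih => exact (hM i).mul ih

/-- The product, in increasing order, of the basis elements indexed by `s`. -/
noncomputable def word {n : ℕ} (s : Finset (Fin n)) : FreeGroup (Fin n) := (s.sort.map FreeGroup.of).prod

/-- The class of `tr' (word s)` in `gr^1(J)`. -/
noncomputable def wordClass {n : ℕ} (s : Finset (Fin n)) : grJ n 1 :=
  Submodule.Quotient.mk ⟨tr' (word s), by simpa using tr'_mem_J (word s)⟩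

/-- The functional is the coefficient of X^(w|s|); the bound w|s| < 4 makes it vanish on J^2. Only
the letters in s contribute degree, at most w each, so the trace of `word t` has degree at most w|s
∩ t|, which is less than w|s| unless s ⊆ t. -/
theorem exists_dual_wordClass_of_matrices {n : ℕ} (s : Finset (Fin n)) (w : ℕ)
    (M : Fin n → SL(2, ℚ⟦X⟧))
    (hM : ∀ i, Matrix.SpecialLinearGroup.map (constantCoeff (R := ℚ)) (M i) = 1)
    (hdeg : ∀ i, EntryDegreeLE (if i ∈ s then w else 0) (M i).1)
    (h0 : 0 < w * s.card) (h4 : w * s.card < 4)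
    (hs : coeff (w * s.card) (s.sort.map M).prod.1.trace ≠ 0) :
    ∃ Λ : grJ n 1 →ₗ[ℚ] ℚ, Λ (wordClass s) ≠ 0 ∧ ∀ t, ¬ s ⊆ t → Λ (wordClass t) = 0 := by
  obtain ⟨Φ, hΦ, hdvd⟩ := exists_algHom_powerSeries M hM
  obtain ⟨Λ, hΛ⟩ := exists_linearMap_grJ hdvd 1 (w * s.card) h4
  have key (t) : Λ (wordClass t) = coeff (w * s.card) (t.sort.map M).prod.1.trace := by
    have h2 : coeff (w * s.card) (2 : ℚ⟦X⟧) = 0 := by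
      rw [← map_ofNat (C (R := ℚ)) 2, coeff_C, if_neg h0.ne']
    rw [wordClass, hΛ]
    change coeff _ (Φ (tr (word t) - 2)) = _
    rw [map_sub, map_ofNat, hΦ, map_sub, h2, sub_zero, word, map_list_prod,
      List.map_map]
    simp only [Function.comp_def, FreeGroup.lift_apply_of]
  refine ⟨Λ, by rwa [key], fun t ht => ?_⟩
  have hlt : (t.sort.map fun i => if i ∈ s then w else 0).sum < w * s.card := by
    have : (t.sort.map fun i => if i ∈ s then w else 0).sum = ∑ i ∈ t, if i ∈ s then w else 0 := by
      rw [← Multiset.sum_coe, ← Multiset.map_coe, Finset.sort_eq]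
      rfl
    rw [this, Finset.sum_ite_mem, Finset.sum_const, smul_eq_mul, mul_comm]
    refine Nat.mul_lt_mul_of_pos_left ?_ (Nat.pos_of_mul_pos_right h0)
    refine Finset.card_lt_card ⟨Finset.inter_subset_right, fun h => ht fun i hi => ?_⟩
    exact (Finset.mem_inter.1 (h hi)).1
  have h := entryDegreeLE_list_prod hdeg t.sort
  rw [key, Matrix.trace_fin_two, map_add, h 0 0 _ hlt, h 1 1 _ hlt, add_zero]

/-- The matrix `1 + X N` with `N` nilpotent. -/
noncomputable def unipotent {A : Type*} [CommRing A] (a b c : A) (h : a * a + b * c = 0) : SL(2, A⟦X⟧) :=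
  ⟨!![1 + C a * X, C b * X; C c * X, 1 - C a * X], by
    rw [Matrix.det_fin_two_of]
    have h' : C (a * a + b * c) = (0 : A⟦X⟧) := by rw [h, map_zero]
    rw [map_add, map_mul, map_mul] at h'
    linear_combination (-X ^ 2) * h'⟩

theorem map_unipotent {A : Type*} [CommRing A] (a b c : A) (h : a * a + b * c = 0) :
    Matrix.SpecialLinearGroup.map (constantCoeff (R := A)) (unipotent a b c h) = 1 := by
  apply Subtype.ext
  change (!![1 + C a * X, C b * X; C c * X, 1 - C a * X]).map constantCoeff = 1
  ext i j
  fin_cases i <;> fin_cases j <;> simp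

theorem entryDegreeLE_unipotent {A : Type*} [CommRing A] (a b c : A) (h : a * a + b * c = 0) :
    EntryDegreeLE 1 (unipotent a b c h).1 := by
  intro i j m hm
  have h0 : m ≠ 0 := by omega
  have h1 : m ≠ 1 := by omega
  change coeff m (!![1 + C a * X, C b * X; C c * X, 1 - C a * X] i j) = 0
  fin_cases i <;> fin_cases j <;> simp [coeff_one, coeff_X, h0, h1]

/-- The matrices are chosen so that the trace of `word s` has the extreme degree w|s|. A single
letter needs w = 2, since the coefficient of X in a trace always vanishes here; two or three letters
use w = 1. -/
theorem exists_dual_wordClass {n : ℕ} (s : Finset (Fin n)) (h1 : 1 ≤ s.card) (h3 : s.card ≤ 3) :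
    ∃ Λ : grJ n 1 →ₗ[ℚ] ℚ, Λ (wordClass s) ≠ 0 ∧ ∀ t, ¬ s ⊆ t → Λ (wordClass t) = 0 := by
  let U : SL(2, ℚ⟦X⟧) := unipotent 0 1 0 (by norm_num)
  let V : SL(2, ℚ⟦X⟧) := unipotent 0 0 1 (by norm_num)
  -- With U = 1 + X E₁₂, V = 1 + X E₂₁ and W = 1 + XN, the X^3-coefficient of the trace of UVW is
  -- tr(E₁₂ E₂₁ N) = N₁₁. Hence a nilpotent N with nonzero upper left entry is taken.
  let W : SL(2, ℚ⟦X⟧) := unipotent 1 (-1) 1 (by norm_num)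
  have hUV : (U * V).1.trace = 2 + X ^ 2 := by
    change (!![1 + C 0 * X, C 1 * X; C 0 * X, 1 - C 0 * X] *
      !![1 + C 0 * X, C 0 * X; C 1 * X, 1 - C 0 * X] : Matrix (Fin 2) (Fin 2) ℚ⟦X⟧).trace = _
    rw [Matrix.mul_fin_two, Matrix.trace_fin_two_of]
    simp
    ring
  have hUVW : (U * (V * W)).1.trace = 2 + X ^ 2 + X ^ 3 := by
    change (!![1 + C 0 * X, C 1 * X; C 0 * X, 1 - C 0 * X] *
      (!![1 + C 0 * X, C 0 * X; C 1 * X, 1 - C 0 * X] *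
        !![1 + C 1 * X, C (-1) * X; C 1 * X, 1 - C 1 * X]) :
          Matrix (Fin 2) (Fin 2) ℚ⟦X⟧).trace = _
    rw [Matrix.mul_fin_two, Matrix.mul_fin_two, Matrix.trace_fin_two_of]
    simp
    ring
  have hc (m : ℕ) (hm : m ≠ 0) : coeff m (2 : ℚ⟦X⟧) = 0 := by
    rw [← map_ofNat (C (R := ℚ)) 2, coeff_C, if_neg hm]
  have hlen : s.sort.length = s.card := Finset.length_sort _
  have hmem (i) : i ∈ s ↔ i ∈ s.sort := (Finset.mem_sort _).symm
  have hnd : s.sort.Nodup := Finset.sort_nodup _ _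
  obtain h | h | h : s.card = 1 ∨ s.card = 2 ∨ s.card = 3 := by omega
  · obtain ⟨a, ha⟩ := List.length_eq_one_iff.1 (hlen.trans h)
    refine exists_dual_wordClass_of_matrices s 2 (fun i => if i = a then U * V else 1)
      (fun i => ?_) (fun i => ?_) (by omega) (by omega) ?_
    · split_ifs
      · rw [map_mul, map_unipotent, map_unipotent, mul_one]
      · exact map_one _
    · simp only [hmem, ha, List.mem_singleton]
      split_ifs
      · exact (entryDegreeLE_unipotent _ _ _ _).mul (entryDegreeLE_unipotent _ _ _ _)
      · exact entryDegreeLE_one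
    · simp only [ha, h, List.map_cons, List.map_nil, if_true, List.prod_singleton, hUV]
      simp [hc]
  · obtain ⟨a, b, hab⟩ := List.length_eq_two.1 (hlen.trans h)
    have hne : b ≠ a := by
      rw [hab] at hnd
      simp at hnd
      tauto
    refine exists_dual_wordClass_of_matrices s 1
      (fun i => if i = a then U else if i = b then V else 1)
      (fun i => ?_) (fun i => ?_) (by omega) (by omega) ?_
    · split_ifs
      · exact map_unipotent _ _ _ _
      · exact map_unipotent _ _ _ _
      · exact map_one _
    · simp only [hmem, hab, List.mem_cons, List.not_mem_nil, or_false]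
      by_cases h1 : i = a
      · simpa [h1] using entryDegreeLE_unipotent _ _ _ _
      · by_cases h2 : i = b
        · simpa [h2, hne] using entryDegreeLE_unipotent _ _ _ _
        · simpa [h1, h2] using entryDegreeLE_one
    · have : ([a, b].map fun i => if i = a then U else if i = b then V else 1).prod = U * V := by
        simp [hne]
      rw [hab, h, this, hUV]
      simp [hc]
  · obtain ⟨a, b, c, habc⟩ := List.length_eq_three.1 (hlen.trans h)
    obtain ⟨hba, hca, hcb⟩ : b ≠ a ∧ c ≠ a ∧ c ≠ b := by
      rw [habc] at hnd
      simp at hnd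
      tauto
    refine exists_dual_wordClass_of_matrices s 1
      (fun i => if i = a then U else if i = b then V else if i = c then W else 1)
      (fun i => ?_) (fun i => ?_) (by omega) (by omega) ?_
    · split_ifs
      · exact map_unipotent _ _ _ _
      · exact map_unipotent _ _ _ _
      · exact map_unipotent _ _ _ _
      · exact map_one _
    · simp only [hmem, habc, List.mem_cons, List.not_mem_nil, or_false]
      by_cases h1 : i = a
      · simpa [h1] using entryDegreeLE_unipotent _ _ _ _
      · by_cases h2 : i = b
        · simpa [h2, hba] using entryDegreeLE_unipotent _ _ _ _
        · by_cases h3 : i = c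
          · simpa [h3, hca, hcb] using entryDegreeLE_unipotent _ _ _ _
          · simpa [h1, h2, h3] using entryDegreeLE_one
    · have : ([a, b, c].map fun i => if i = a then U else if i = b then V else if i = c then W
          else 1).prod = U * (V * W) := by
        simp [hba, hca, hcb]
      rw [habc, h, this, hUVW]
      simp [hc, coeff_X_pow]

/-- The classes of the generators `tr' (x_{i_1} ⋯ x_{i_l})` are linearly independent in
`gr^1(J)`. -/
theorem linearIndependent_wordClass (n : ℕ) :
    LinearIndependent ℚ
      (fun s : {s : Finset (Fin n) // 1 ≤ s.card ∧ s.card ≤ 3} => wordClass s.1) := by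
  rw [Fintype.linearIndependent_iff]
  intro c hc s
  -- Downward induction on inclusion: the functional for s kills every t not containing s, and
  -- strictly larger t already have coefficient 0.
  induction s using WellFoundedGT.induction with
  | ind s ih =>
  obtain ⟨Λ, hs, ht⟩ := exists_dual_wordClass s.1 s.2.1 s.2.2
  have h := congrArg Λ hc
  rw [map_sum, map_zero, Finset.sum_eq_single s] at h
  · rw [map_smul, smul_eq_mul] at h
    exact (mul_eq_zero.1 h).resolve_right hs
  · intro t _ hts
    by_cases hst : s.1 ⊆ t.1
    · rw [ih t (lt_of_le_of_ne hst (Ne.symm hts)), zero_smul, map_zero]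
    · rw [map_smul, ht _ hst, smul_zero]
  · exact fun h => absurd (Finset.mem_univ s) h

end Fricke

/-! ### Linear algebra: a lower bound for the dimension of a quotient of Hom(V, W) -/

theorem LinearIndependent.exists_linearMap_apply_eq {K V W ι : Type*} [Field K] [AddCommGroup V]
    [Module K V] [AddCommGroup W] [Module K W] {v : ι → V} (hv : LinearIndependent K v)
    (w : ι → W) : ∃ g : V →ₗ[K] W, ∀ i, g (v i) = w i := by
  obtain ⟨g, hg⟩ := LinearMap.exists_extend ((Module.Basis.span hv).constr K w)
  refine ⟨g, fun i => ?_⟩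
  have h := (Module.Basis.span hv).constr_basis K w i
  rw [← hg] at h
  rw [← h, LinearMap.comp_apply, Submodule.subtype_apply, Module.Basis.span_apply]

/-- If a linear map `Θ` kills every element of a subspace `P` of `Hom(V, W)`, and the range of `Θ`
contains the linearly independent family `u`, then `Hom(V, W) / P` has dimension at least the
number of elements of `u` times that of a linearly independent family in `V`. -/
theorem card_mul_card_le_rank_quotient {K V W U ι κ : Type} [Field K] [AddCommGroup V]
    [Module K V] [AddCommGroup W] [Module K W] [AddCommGroup U] [Module K U] [Fintype ι]
    [Fintype κ] (P : Submodule K (V →ₗ[K] W)) (Θ : W →ₗ[K] U) (hP : ∀ h ∈ P, Θ ∘ₗ h = 0)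
    {v : ι → V} (hv : LinearIndependent K v) {u : κ → U} (hu : LinearIndependent K u)
    (huΘ : ∀ j, u j ∈ LinearMap.range Θ) :
    ((Fintype.card ι * Fintype.card κ : ℕ) : Cardinal) ≤ Module.rank K ((V →ₗ[K] W) ⧸ P) := by
  classical
  choose w hw using huΘ
  -- `D` extends the coordinates with respect to `u`. Then `Ψ` reads off the matrix of Θ ∘ h from
  -- `v` to `u`, and it factors through the quotient.
  obtain ⟨D, hD⟩ := hu.exists_linearMap_apply_eq fun j => (Pi.single j 1 : κ → K)
  let Ψ : (V →ₗ[K] W) →ₗ[K] (ι × κ → K) :=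
    { toFun := fun h p => D (Θ (h (v p.1))) p.2
      map_add' := fun _ _ => by ext; simp
      map_smul' := fun _ _ => by ext; simp }
  have hΨ : P ≤ LinearMap.ker Ψ := fun h hh => by
    ext p
    change D ((Θ ∘ₗ h) (v p.1)) p.2 = 0
    simp [hP h hh]
  have hsurj : Function.Surjective (P.liftQ Ψ hΨ) := by
    intro c
    -- Any matrix `c` is attained: independence of `v` lets the values of h be prescribed as
    -- combinations of the lifts `w j` of `u j`.
    obtain ⟨h, hh⟩ := hv.exists_linearMap_apply_eq fun i => ∑ j, c (i, j) • w j
    refine ⟨Submodule.Quotient.mk h, ?_⟩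
    ext ⟨i, j⟩
    change D (Θ (h (v i))) j = c (i, j)
    simp [hh, hw, hD, Finset.sum_apply, Pi.single_apply]
  have h := LinearMap.rank_le_of_surjective _ hsurj
  rw [rank_fun', Fintype.card_prod] at h
  simpa using h

/-! ### Counting monomials of even degree and generators -/

/-- Multisets with a prescribed number `2 * l` of elements of odd multiplicity: such a multiset is
a set with `2 * l` elements plus twice a multiset. -/
abbrev OddEvenSplit (n m : ℕ) : Type :=
  Σ l : Fin (m + 1), {A : Finset (Fin n) // A.card = 2 * l} × Sym (Fin n) (m - l)

theorem OddEvenSplit.card (n k : ℕ) : Fintype.card (OddEvenSplit n (k + 1)) =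
    ∑ l ∈ Finset.range (k + 2), n.choose (2 * l) * (n + k - l).choose (k + 1 - l) := by
  rw [Fintype.card_sigma, Finset.sum_range]
  refine Finset.sum_congr rfl fun l _ => ?_
  have hl : l.1 < k + 2 := l.2
  rw [Fintype.card_prod, Fintype.card_finset_len, Sym.card_sym_eq_choose, Fintype.card_fin]
  -- The number of multisets has upper index n + (k + 1 - l) - 1, which is n + k - l because l ≤ k +
  -- 1.
  congr 2
  omega

/-- The multiset with the given splitting. -/
def OddEvenSplit.toMultiset {n m : ℕ} (x : OddEvenSplit n m) : Multiset (Fin n) :=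
  x.2.1.1.val + 2 • (x.2.2 : Multiset (Fin n))

theorem OddEvenSplit.card_toMultiset {n m : ℕ} (x : OddEvenSplit n m) :
    Multiset.card x.toMultiset = 2 * m := by
  obtain ⟨l, ⟨A, hA⟩, T⟩ := x
  have hl : l.1 < m + 1 := l.2
  have hT : Multiset.card (T : Multiset (Fin n)) = m - l := T.2
  have hA' : Multiset.card A.val = 2 * l := hA
  simp only [toMultiset, Multiset.card_add, Multiset.card_nsmul, hT, hA']
  omega

/-- Parities of the multiplicities recover the set, its size recovers l, and halving what remains
recovers the other multiset. -/
theorem OddEvenSplit.toMultiset_injective {n m : ℕ} :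
    Function.Injective (OddEvenSplit.toMultiset (n := n) (m := m)) := by
  rintro ⟨l, ⟨A, hA⟩, T⟩ ⟨l', ⟨A', hA'⟩, T'⟩ h
  have hcount (i : Fin n) : (if i ∈ A then 1 else 0) + 2 * (T : Multiset (Fin n)).count i =
      (if i ∈ A' then 1 else 0) + 2 * (T' : Multiset (Fin n)).count i := by
    simpa [toMultiset, Multiset.count_eq_of_nodup A.nodup, Multiset.count_eq_of_nodup A'.nodup]
      using congrArg (Multiset.count i) h
  obtain rfl : A = A' := by
    ext i
    have := hcount i
    split_ifs at this <;> first | tauto | omega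
  obtain rfl : l = l' := Fin.ext (by omega)
  obtain rfl : T = T' := Subtype.ext (Multiset.ext.2 fun i => by simpa using hcount i)
  rfl

theorem Finset.card_subtype_card_mem_Icc_one_three (n : ℕ) :
    Fintype.card {s : Finset (Fin n) // 1 ≤ s.card ∧ s.card ≤ 3} =
      n + n.choose 2 + n.choose 3 := by
  rw [Fintype.card_subtype, Finset.card_eq_sum_card_fiberwise (f := Finset.card)
    (t := Finset.Icc 1 3) (fun s hs => by simpa using hs)]
  have h (j) (hj : j ∈ Finset.Icc 1 3) :
      (({s : Finset (Fin n) | 1 ≤ s.card ∧ s.card ≤ 3} : Finset _).filter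
        (fun s => s.card = j)).card = n.choose j := by
    have hcard : (Finset.powersetCard j (Finset.univ : Finset (Fin n))).card = n.choose j := by
      rw [Finset.card_powersetCard, Finset.card_fin]
    rw [← hcard]
    congr 1
    ext s
    simp only [Finset.mem_Icc] at hj
    simp only [Finset.mem_filter, Finset.mem_univ, true_and, Finset.mem_powersetCard,
      Finset.subset_univ]
    omega
  rw [Finset.sum_congr rfl h]
  simp [Finset.sum_Icc_succ_top]

/-! ### The lower bound for the cokernel -/

theorem mainTheorem8 (n k : ℕ) (hn : 3 ≤ n) (hk : 2 ≤ k) :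
    (((n + n.choose 2 + n.choose 3) *
        ∑ l ∈ Finset.range (k + 2), n.choose (2 * l) * (n + k - l).choose (k + 1 - l) : ℕ) :
      Cardinal) ≤
    Module.rank ℚ (Fricke.etaCoker n k (one_le_two.trans hk)) := by
  obtain ⟨Φ, hdvd, hinv, hmon⟩ := Fricke.exists_diagonal_expansion n
  -- The coefficient of X^(2k+2) is the leading one on J^(k+1) and vanishes on J^(k+2), whose
  -- expansions start at X^(2k+4).
  obtain ⟨Θ, hΘ⟩ := Fricke.exists_linearMap_grJ hdvd (k + 1) (2 * (k + 1)) (by omega)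
  have hη : ∀ h ∈ Fricke.etaImage n k (one_le_two.trans hk), Θ ∘ₗ h = 0 := by
    intro h hh
    induction hh using Submodule.span_induction with
    | mem h hh =>
      obtain ⟨s, rfl⟩ := hh
      obtain ⟨σ, rfl⟩ := QuotientGroup.mk_surjective s
      apply Submodule.linearMap_qext
      ext1 f
      refine (hΘ (Fricke.etaAux n k σ f)).trans ?_
      -- Since k ≥ 1, 𝓔(k) is contained in 𝓔(1), whose elements leave the diagonal expansion
      -- unchanged.
      have hσ : σ.1 ∈ Fricke.E n 1 := fun f hf =>
        Ideal.pow_le_pow_right (by omega) (σ.2 f hf)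
      change PowerSeries.coeff _ (Φ (Fricke.action σ.1 f.1 - f.1)) = 0
      rw [map_sub, hinv _ hσ, sub_self, map_zero]
    | zero => exact LinearMap.comp_zero _
    | add f g _ _ hf hg => rw [LinearMap.comp_add, hf, hg, add_zero]
    | smul c f _ hf => rw [LinearMap.comp_smul, hf, smul_zero]
  have hu : LinearIndependent ℚ fun x : OddEvenSplit n (k + 1) =>
      (MvPolynomial.monomial (Multiset.toFinsupp x.toMultiset) 1 : MvPolynomial (Fin n) ℚ) := by
    have h := (MvPolynomial.basisMonomials (Fin n) ℚ).linearIndependent.comp _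
      (Multiset.toFinsupp.injective.comp
        (OddEvenSplit.toMultiset_injective (n := n) (m := k + 1)))
    rwa [MvPolynomial.coe_basisMonomials] at h
  rw [← Finset.card_subtype_card_mem_Icc_one_three, ← OddEvenSplit.card]
  refine card_mul_card_le_rank_quotient _ Θ hη (Fricke.linearIndependent_wordClass n) hu ?_
  intro x
  obtain ⟨f, hf, hf'⟩ := hmon (k + 1) (Multiset.toFinsupp x.toMultiset) (by
    have h := Finsupp.card_toMultiset (Multiset.toFinsupp x.toMultiset)
    rw [Multiset.toFinsupp_toMultiset, x.card_toMultiset] at h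
    exact h.symm)
  exact ⟨Submodule.Quotient.mk ⟨f, hf⟩, (hΘ _).trans hf'⟩
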